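/- For a partition $\lambda$ of $n$, drawn as a left-justified array of boxes whose rows from top to bottom have lengths the parts of $\lambda$ in weakly decreasing order, the hook number of a box is the number of boxes to its right in the same row, plus the number of boxes below it in the same column, plus $1$; let $H(\lambda)$ be the multiset of the hook numbers of all boxes of $\lambda$. Theorem. Let $k$ and $\ell$ be natural numbers. Then there is an integer $N$ such that for every $n \ge N$ there are pairwise disjoint sets $\Lambda_1, \dots, \Lambda_k$, each consisting of exactly $\ell$ partitions of $n$, with the following properties. For every $i$ and all $\lambda, \mu \in \Lambda_i$ we have $H(\lambda) = H(\mu)$. For all $i \ne j$, all $\lambda \in \Lambda_i$ and all $\mu \in \Lambda_j$ we have $H(\lambda) \ne H(\mu)$, and moreover $\prod_{h \in H(\lambda)} h \ne \prod_{h \in H(\mu)} h$ (products taken with multiplicity). -/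

import Mathlib

/-- The Young diagram of a partition: row `i` (counted from `0`, top to bottom) has as many boxes
as the `i`-th largest part. A box is a pair `(row, column)`. -/
def Nat.Partition.diagram {n : ℕ} (p : n.Partition) : YoungDiagram :=
  YoungDiagram.ofRowLens (p.parts.sort (· ≥ ·))
    (Multiset.pairwise_sort p.parts (· ≥ ·)).sortedGE

/-- The hook number of a box `a` of a Young diagram: the number of boxes to the right of `a`, plus
the number of boxes below `a`, plus `1` for `a` itself. -/
def YoungDiagram.hookNumber (μ : YoungDiagram) (a : ℕ × ℕ) : ℕ :=
  (μ.cells.filter fun b => b.1 = a.1 ∧ a.2 < b.2).card +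
    (μ.cells.filter fun b => b.2 = a.2 ∧ a.1 < b.1).card + 1

/-- The multiset of hook numbers of all the boxes of a partition. -/
def Nat.Partition.hookNumbers {n : ℕ} (p : n.Partition) : Multiset ℕ :=
  p.diagram.cells.val.map p.diagram.hookNumber

/-! The boundary of a diagram, read as a two-sided 0-1 word `s`, turns boxes with hook number `t`
into pairs with a 0 at `y` and a 1 at `y + t`. So the hook multiset amounts to the squared distances
`corr s t` between `s` and its translates.

Multiplying the generating series of `s` by `1 - x^a + x^b` (`envelope`) gives a word whose `corr`
depends only on that of `s` (`corr_envelope`) and adds `a * (b - a)` boxes. Conjugation preserves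
hook numbers too, but never maps an envelope to an envelope when `b > 2 * a`. Adjoining conjugates
therefore doubles a family with common hook numbers (`IsFamily.double`), and iteration reaches any
cardinality.

In the last doubling `a = q` is free, and `b` is about `n / q`. All hooks are then at most `2n/q`,
while every `t` from `2q` to `n/(2q)` occurs. If `q' ≥ 16 * q`, Bertrand's postulate gives a prime
that is a hook at scale `q` and exceeds every hook at scale `q'`, so the products differ. -/

namespace YoungDiagram

/-! ### Boundary steps and hook numbers. -/

/-- The position of the vertical boundary step at the end of row `i`. -/
def bead (μ : YoungDiagram) (i : ℕ) : ℤ := μ.rowLen i - i - 1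

/-- The position of the horizontal boundary step at the bottom of column `j`. -/
def gap (μ : YoungDiagram) (j : ℕ) : ℤ := j - μ.colLen j

theorem lt_rowLen_iff_lt_colLen (μ : YoungDiagram) (i j : ℕ) :
    j < μ.rowLen i ↔ i < μ.colLen j := by
  rw [← mem_iff_lt_rowLen, ← mem_iff_lt_colLen]

theorem gap_lt_bead_iff (μ : YoungDiagram) (i j : ℕ) : μ.gap j < μ.bead i ↔ (i, j) ∈ μ := by
  have h := μ.lt_rowLen_iff_lt_colLen i j
  rw [mem_iff_lt_rowLen]
  unfold gap bead
  by_cases hj : j < μ.rowLen i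
  · have := h.1 hj
    omega
  · have : ¬ i < μ.colLen j := fun h' => hj (h.2 h')
    omega

theorem gap_ne_bead (μ : YoungDiagram) (i j : ℕ) : μ.gap j ≠ μ.bead i := by
  have h := μ.lt_rowLen_iff_lt_colLen i j
  unfold gap bead
  by_cases hj : j < μ.rowLen i
  · have := h.1 hj
    omega
  · have : ¬ i < μ.colLen j := fun h' => hj (h.2 h')
    omega

theorem bead_strictAnti (μ : YoungDiagram) : StrictAnti μ.bead := by
  intro i i' h
  have := μ.rowLen_anti i i' h.le
  unfold bead
  omega

theorem gap_strictMono (μ : YoungDiagram) : StrictMono μ.gap := by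
  intro j j' h
  have := μ.colLen_anti j j' h.le
  unfold gap
  omega

/-- If `i` is the first row whose bead is at most `m`, then `m` lies strictly between beads `i - 1`
and `i`, hence on the bottom of column `m + i`, which has height `i`. -/
theorem exists_gap_of_not_bead (μ : YoungDiagram) {m : ℤ} (hm : ∀ i, m ≠ μ.bead i) :
    ∃ j, m = μ.gap j := by
  have hex : ∃ i : ℕ, μ.bead i ≤ m := by
    refine ⟨μ.rowLen 0 + m.natAbs, ?_⟩
    have := μ.rowLen_anti 0 (μ.rowLen 0 + m.natAbs) (Nat.zero_le _)
    unfold bead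
    omega
  classical
  let i := Nat.find hex
  have hi : μ.bead i ≤ m := Nat.find_spec hex
  have hne := hm i
  have hlt : μ.bead i < m := lt_of_le_of_ne hi (Ne.symm hne)
  have hj : 0 ≤ m + i := by unfold bead at hlt; omega
  obtain ⟨j, hj⟩ := Int.eq_ofNat_of_zero_le hj
  refine ⟨j, ?_⟩
  have h1 : ¬ i < μ.colLen j := by
    rw [← lt_rowLen_iff_lt_colLen]
    unfold bead at hlt
    omega
  have h2 : i ≤ μ.colLen j := by
    rcases Nat.eq_zero_or_pos i with h0 | h0
    · omega
    · have := Nat.find_min hex (show i - 1 < Nat.find hex from Nat.sub_lt h0 one_pos)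
      have h3 : i - 1 < μ.colLen j := by
        rw [← lt_rowLen_iff_lt_colLen]
        unfold bead at this
        omega
      omega
  unfold gap
  omega

theorem card_right (μ : YoungDiagram) (i j : ℕ) :
    (μ.cells.filter fun b => b.1 = i ∧ j < b.2).card = μ.rowLen i - j - 1 := by
  have : (μ.cells.filter fun b => b.1 = i ∧ j < b.2) =
      (Finset.Ioo j (μ.rowLen i)).image fun c => (i, c) := by
    ext ⟨x, y⟩
    simp only [Finset.mem_filter, mem_cells, mem_iff_lt_rowLen, Finset.mem_image, Finset.mem_Ioo,
      Prod.mk.injEq]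
    constructor
    · rintro ⟨h, rfl, h'⟩
      exact ⟨y, ⟨h', h⟩, rfl, rfl⟩
    · rintro ⟨c, ⟨h', h⟩, rfl, rfl⟩
      exact ⟨h, rfl, h'⟩
  rw [this, Finset.card_image_of_injective _ fun _ _ h => (Prod.mk.inj h).2, Nat.card_Ioo]

theorem card_below (μ : YoungDiagram) (i j : ℕ) :
    (μ.cells.filter fun b => b.2 = j ∧ i < b.1).card = μ.colLen j - i - 1 := by
  have : (μ.cells.filter fun b => b.2 = j ∧ i < b.1) =
      (Finset.Ioo i (μ.colLen j)).image fun c => (c, j) := by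
    ext ⟨x, y⟩
    simp only [Finset.mem_filter, mem_cells, mem_iff_lt_colLen, Finset.mem_image, Finset.mem_Ioo,
      Prod.mk.injEq]
    constructor
    · rintro ⟨h, rfl, h'⟩
      exact ⟨x, ⟨h', h⟩, rfl, rfl⟩
    · rintro ⟨c, ⟨h', h⟩, rfl, rfl⟩
      exact ⟨h, rfl, h'⟩
  rw [this, Finset.card_image_of_injective _ fun _ _ h => (Prod.mk.inj h).1, Nat.card_Ioo]

theorem hookNumber_eq_bead_sub_gap (μ : YoungDiagram) {i j : ℕ} (h : (i, j) ∈ μ) :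
    (μ.hookNumber (i, j) : ℤ) = μ.bead i - μ.gap j := by
  have h1 := mem_iff_lt_rowLen.1 h
  have h2 := mem_iff_lt_colLen.1 h
  unfold hookNumber bead gap
  simp only [card_right, card_below]
  omega

/-- A box is a gap together with a later bead, and its hook number is their distance. -/
theorem ncard_gap_bead (μ : YoungDiagram) {t : ℕ} (ht : 0 < t) :
    {y : ℤ | (∀ i, y ≠ μ.bead i) ∧ ∃ i, y + t = μ.bead i}.ncard =
      (μ.cells.val.map μ.hookNumber).count t := by
  classical
  rw [Multiset.count_map]
  change _ = (μ.cells.filter fun a => t = μ.hookNumber a).card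
  rw [← Set.ncard_coe_finset]
  symm
  refine Set.ncard_congr (fun a _ => μ.gap a.2) ?_ ?_ ?_
  · rintro ⟨i, j⟩ ha
    simp only [Finset.coe_filter, mem_cells, Set.mem_ofPred_eq] at ha
    have := μ.hookNumber_eq_bead_sub_gap ha.1
    exact ⟨fun i => μ.gap_ne_bead i j, i, by rw [ha.2, this]; ring⟩
  · rintro ⟨i, j⟩ ⟨i', j'⟩ ha ha' hg
    simp only [Finset.coe_filter, mem_cells, Set.mem_ofPred_eq] at ha ha' hg
    have h1 := μ.hookNumber_eq_bead_sub_gap ha.1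
    have h2 := μ.hookNumber_eq_bead_sub_gap ha'.1
    rw [← ha.2] at h1
    rw [← ha'.2] at h2
    have hb : μ.bead i = μ.bead i' := by omega
    exact Prod.ext (μ.bead_strictAnti.injective hb) (μ.gap_strictMono.injective hg)
  · rintro y ⟨hy, i, hi⟩
    obtain ⟨j, rfl⟩ := μ.exists_gap_of_not_bead hy
    have hmem : (i, j) ∈ μ := (μ.gap_lt_bead_iff i j).1 (by omega)
    have := μ.hookNumber_eq_bead_sub_gap hmem
    refine ⟨(i, j), ?_, rfl⟩
    simp only [Finset.coe_filter, mem_cells, Set.mem_ofPred_eq]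
    exact ⟨hmem, by omega⟩

/-! ### Diagrams built row by row. -/

/-- The Young diagram obtained by adding a new top row. -/
def consRow (μ : YoungDiagram) (l : ℕ) (h : μ.rowLen 0 ≤ l) : YoungDiagram where
  cells := (Finset.range l).image (fun c => (0, c)) ∪ μ.cells.image (fun a => (a.1 + 1, a.2))
  isLowerSet := by
    rintro ⟨i, j⟩ ⟨i', j'⟩ ⟨hi, hj⟩ hm
    simp only [Finset.coe_union, Finset.coe_image, Set.mem_union, Set.mem_image, Finset.mem_coe,
      Finset.mem_range, mem_cells, Prod.mk.injEq, Prod.exists] at hm ⊢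
    dsimp only at hi hj
    rcases i' with _ | i'
    · left
      rcases hm with ⟨c, hc, h0, h1⟩ | ⟨x, y, ha, h0, h1⟩
      · exact ⟨j', by omega, rfl, rfl⟩
      · have h2 := mem_iff_lt_rowLen.1 ha
        have h3 := μ.rowLen_anti 0 x (Nat.zero_le _)
        exact ⟨j', by omega, rfl, rfl⟩
    · right
      rcases hm with ⟨c, hc, h0, h1⟩ | ⟨x, y, ha, h0, h1⟩
      · omega
      · exact ⟨i', j', μ.up_left_mem (by omega) (by omega) ha, rfl, rfl⟩

theorem card_consRow (μ : YoungDiagram) (l : ℕ) (h : μ.rowLen 0 ≤ l) :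
    (μ.consRow l h).card = l + μ.card := by
  unfold YoungDiagram.card consRow
  rw [Finset.card_union_of_disjoint]
  · rw [Finset.card_image_of_injective _ fun _ _ h => (Prod.mk.inj h).2, Finset.card_range,
      Finset.card_image_of_injective]
    intro a b h
    simp only [Prod.mk.injEq, add_left_inj] at h
    exact Prod.ext h.1 h.2
  · rw [Finset.disjoint_left]
    rintro ⟨i, j⟩ h1 h2
    simp only [Finset.mem_image, Prod.mk.injEq] at h1 h2
    obtain ⟨_, _, rfl, _⟩ := h1
    obtain ⟨_, _, h, _⟩ := h2
    omega

theorem mem_consRow_zero (μ : YoungDiagram) (l : ℕ) (h : μ.rowLen 0 ≤ l) (j : ℕ) :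
    (0, j) ∈ μ.consRow l h ↔ j < l := by
  rw [← mem_cells]
  simp [consRow]

theorem mem_consRow_succ (μ : YoungDiagram) (l : ℕ) (h : μ.rowLen 0 ≤ l) (i j : ℕ) :
    (i + 1, j) ∈ μ.consRow l h ↔ (i, j) ∈ μ := by
  rw [← mem_cells]
  simp [consRow]

theorem rowLen_consRow_zero (μ : YoungDiagram) (l : ℕ) (h : μ.rowLen 0 ≤ l) :
    (μ.consRow l h).rowLen 0 = l :=
  eq_of_forall_lt_iff fun j => by rw [← mem_iff_lt_rowLen, mem_consRow_zero]

theorem rowLen_consRow_succ (μ : YoungDiagram) (l : ℕ) (h : μ.rowLen 0 ≤ l) (i : ℕ) :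
    (μ.consRow l h).rowLen (i + 1) = μ.rowLen i :=
  eq_of_forall_lt_iff fun j => by rw [← mem_iff_lt_rowLen, mem_consRow_succ, mem_iff_lt_rowLen]

theorem exists_partition_diagram_eq (μ : YoungDiagram) :
    ∃ p : Nat.Partition μ.card, p.diagram = μ := by
  have hsum : μ.rowLens.sum = μ.card := by
    have h : μ.card = ∑ i ∈ Finset.range (μ.colLen 0), (μ.row i).card := by
      refine Finset.card_eq_sum_card_fiberwise fun a ha => ?_
      have : (a.1, 0) ∈ μ := μ.up_left_mem le_rfl (Nat.zero_le _) ha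
      simpa using mem_iff_lt_colLen.1 this
    simp only [h, ← rowLen_eq_card]
    rfl
  refine ⟨⟨(μ.rowLens : Multiset ℕ), fun {i} hi => μ.pos_of_mem_rowLens i (by simpa using hi),
    by simpa using hsum⟩, ?_⟩
  unfold Nat.Partition.diagram
  have : (Multiset.sort (μ.rowLens : Multiset ℕ) (· ≥ ·)) = μ.rowLens := by
    rw [Multiset.coe_sort]
    exact List.mergeSort_eq_self _ μ.rowLens_sorted.pairwise
  simp only [this]
  exact μ.ofRowLens_to_rowLens_eq_self

end YoungDiagram

/-! ### 0-1 words and their correlations. -/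

/-- `s` is a word of length `N` with letters `0` and `1`, preceded by ones and followed by zeros:
read from left to right, it is the boundary of a Young diagram, a `1` being a vertical step. -/
structure IsWord (N : ℕ) (s : ℤ → ℤ) : Prop where
  zero_or_one : ∀ i, s i = 0 ∨ s i = 1
  eq_one : ∀ i < 0, s i = 1
  eq_zero : ∀ i, (N : ℤ) ≤ i → s i = 0

/-- A word that starts with `0` and ends with `1`. -/
structure IsTrimmed (N : ℕ) (s : ℤ → ℤ) : Prop extends IsWord N s where
  first : s 0 = 0
  last : s (N - 1) = 1

/-- The number of ones in a word of length `N`. -/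
def charge (N : ℕ) (s : ℤ → ℤ) : ℤ := ∑ x ∈ Finset.range N, s x

/-- Twice the number of boxes of the Young diagram of a word of length `N`. -/
def doubleSize (N : ℕ) (s : ℤ → ℤ) : ℤ :=
  2 * ∑ x ∈ Finset.range N, (x : ℤ) * s x - charge N s * (charge N s - 1)

/-- The squared distance between a word and its translate by `t`. -/
noncomputable def corr (s : ℤ → ℤ) (t : ℤ) : ℤ := ∑' i, (s (i + t) - s i) ^ 2

namespace IsWord

variable {N : ℕ} {s : ℤ → ℤ}

/-- Induction on the last letter: a final 0 changes nothing, and a final 1 adds a top row with one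
box for each earlier 0. -/
theorem exists_youngDiagram (h : IsWord N s) :
    ∃ μ : YoungDiagram, (∀ x, s x = 1 ↔ ∃ i, x - charge N s = μ.bead i) ∧
      2 * (μ.card : ℤ) = doubleSize N s := by
  induction N generalizing s with
  | zero =>
    refine ⟨⊥, fun x => ?_, by simp [doubleSize, charge, YoungDiagram.card]⟩
    have hb : ∀ i, YoungDiagram.bead ⊥ i = -(i : ℤ) - 1 := fun i => by
      have : YoungDiagram.rowLen ⊥ i = 0 := by
        by_contra hne
        exact YoungDiagram.notMem_bot (i, 0)
          (YoungDiagram.mem_iff_lt_rowLen.2 (Nat.pos_of_ne_zero hne))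
      rw [YoungDiagram.bead, this]
      simp
    simp only [hb, charge, Finset.range_zero, Finset.sum_empty, sub_zero]
    constructor
    · intro hx
      have : x < 0 := by
        by_contra hx0
        have := h.eq_zero x (by simpa using hx0)
        omega
      exact ⟨(-x - 1).toNat, by omega⟩
    · rintro ⟨i, hi⟩
      exact h.eq_one x (by omega)
  | succ N ih =>
    have hs' : IsWord N (Function.update s N 0) := by
      refine ⟨fun i => ?_, fun i hi => ?_, fun i hi => ?_⟩
      · by_cases hiN : i = N
        · simp [hiN]
        · simpa [hiN] using h.zero_or_one i
      · rw [Function.update_of_ne (by omega)]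
        exact h.eq_one i hi
      · by_cases hiN : i = N
        · simp [hiN]
        · rw [Function.update_of_ne hiN]
          exact h.eq_zero i (by push_cast; omega)
    obtain ⟨μ, hμ, hcard⟩ := ih hs'
    have hsum : ∀ f : ℕ → ℤ, ∑ x ∈ Finset.range N, f x * Function.update s N 0 x =
        ∑ x ∈ Finset.range N, f x * s x := fun f =>
      Finset.sum_congr rfl fun x hx => by
        rw [Function.update_of_ne (by have := Finset.mem_range.1 hx; omega)]
    have hcharge : charge N (Function.update s N 0) = charge N s := by
      simpa [charge] using hsum fun _ => 1
    have hsize : doubleSize N (Function.update s N 0) = doubleSize N s := by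
      rw [doubleSize, hsum fun x => (x : ℤ), hcharge, doubleSize]
    rw [hcharge] at hμ
    rw [hsize] at hcard
    have hch : charge (N + 1) s = charge N s + s N := Finset.sum_range_succ _ _
    rcases h.zero_or_one N with h0 | h1
    · rw [← h0, Function.update_eq_self] at hμ
      refine ⟨μ, by simpa only [hch, h0, add_zero] using hμ, ?_⟩
      rw [hcard, doubleSize, doubleSize, hch, Finset.sum_range_succ, h0]
      simp
    · have hrow : (μ.rowLen 0 : ℤ) ≤ N - charge N s := by
        by_contra hlt
        have hone := (hμ (μ.bead 0 + charge N s)).2 ⟨0, by ring⟩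
        have hge : (N : ℤ) ≤ μ.bead 0 + charge N s := by
          unfold YoungDiagram.bead
          push_cast
          omega
        have := hs'.eq_zero _ hge
        omega
      obtain ⟨l, hl⟩ := Int.eq_ofNat_of_zero_le (show 0 ≤ (N : ℤ) - charge N s by omega)
      have hle : μ.rowLen 0 ≤ l := by omega
      refine ⟨μ.consRow l hle, fun x => ?_, ?_⟩
      · have hb0 : (μ.consRow l hle).bead 0 = l - 1 := by
          simp [YoungDiagram.bead, YoungDiagram.rowLen_consRow_zero]
        have hb : ∀ i, (μ.consRow l hle).bead (i + 1) = μ.bead i - 1 := fun i => by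
          simp only [YoungDiagram.bead, YoungDiagram.rowLen_consRow_succ]
          push_cast
          ring
        rw [hch, h1]
        by_cases hx : x = N
        · subst hx
          simp only [h1, true_iff]
          exact ⟨0, by rw [hb0]; omega⟩
        · have hx' := hμ x
          rw [Function.update_of_ne hx] at hx'
          rw [hx']
          constructor
          · rintro ⟨i, hi⟩
            exact ⟨i + 1, by rw [hb]; omega⟩
          · rintro ⟨i, hi⟩
            rcases i with _ | i
            · rw [hb0] at hi
              omega
            · rw [hb] at hi
              exact ⟨i, by omega⟩
      · rw [YoungDiagram.card_consRow, Nat.cast_add, mul_add, hcard, doubleSize, doubleSize, hch,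
          Finset.sum_range_succ, h1, ← hl]
        ring

theorem corr_eq (h : IsWord N s) (t : ℕ) :
    corr s t = 2 * ({y : ℤ | s y = 0 ∧ s (y + t) = 1}.ncard : ℤ) + t := by
  classical
  have hsub : ∀ i ∉ Finset.Ico (-t : ℤ) N, (s (i + t) - s i) ^ 2 = 0 := by
    intro i hi
    simp only [Finset.mem_Ico, not_and_or, not_le, not_lt] at hi
    rcases hi with hi | hi
    · simp [h.eq_one i (by omega), h.eq_one (i + t) (by omega)]
    · simp [h.eq_zero i hi, h.eq_zero (i + t) (by omega)]
  have hset : {y : ℤ | s y = 0 ∧ s (y + t) = 1} =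
      ((Finset.Ico (-t : ℤ) N).filter fun y => s y = 0 ∧ s (y + t) = 1 : Finset ℤ) := by
    ext y
    simp only [Set.mem_ofPred_eq, Finset.coe_filter, Finset.mem_Ico]
    refine ⟨fun hy => ⟨⟨?_, ?_⟩, hy⟩, fun hy => hy.2⟩
    · by_contra hlt
      have := h.eq_one y (by omega)
      omega
    · by_contra hlt
      have := h.eq_zero (y + t) (by omega)
      omega
  have htele : ∑ i ∈ Finset.Ico (-t : ℤ) N, (s (i + t) - s i) = -t := by
    have h1 : ∑ i ∈ Finset.Ico (-t : ℤ) N, s (i + t) = ∑ i ∈ Finset.Ico (0 : ℤ) (N + t), s i := by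
      rw [← neg_add_cancel (t : ℤ), ← Finset.sum_Ico_add']
    have h2 : ∑ i ∈ Finset.Ico (0 : ℤ) (N + t), s i = ∑ i ∈ Finset.Ico (0 : ℤ) N, s i := by
      symm
      refine Finset.sum_subset (Finset.Ico_subset_Ico_right (by omega)) fun i hi hi' => ?_
      simp only [Finset.mem_Ico] at hi hi'
      exact h.eq_zero i (by omega)
    have h3 : ∑ i ∈ Finset.Ico (-t : ℤ) N, s i = t + ∑ i ∈ Finset.Ico (0 : ℤ) N, s i := by
      rw [← Finset.Ico_union_Ico_eq_Ico (show (-t : ℤ) ≤ 0 by omega) (show (0 : ℤ) ≤ N by omega),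
        Finset.sum_union (Finset.Ico_disjoint_Ico_consecutive _ _ _)]
      congr 1
      rw [Finset.sum_congr rfl fun i hi => h.eq_one i (Finset.mem_Ico.1 hi).2]
      simp
    rw [Finset.sum_sub_distrib, h1, h2, h3]
    ring
  -- For letters 0 and 1 the square counts rises and falls alike; it is twice the rises minus the
  -- signed difference, whose sum `htele` evaluates.
  have hpt : ∀ i, (s (i + t) - s i) ^ 2 =
      2 * (if s i = 0 ∧ s (i + t) = 1 then 1 else 0) - (s (i + t) - s i) := by
    intro i
    rcases h.zero_or_one i with h0 | h0 <;> rcases h.zero_or_one (i + t) with h1 | h1 <;>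
      simp [h0, h1]
  rw [corr, tsum_eq_sum hsub, Finset.sum_congr rfl fun i _ => hpt i,
    Finset.sum_sub_distrib, ← Finset.mul_sum, htele, hset, Set.ncard_coe_finset,
    Finset.card_filter]
  push_cast
  ring

end IsWord

namespace IsWord

variable {N : ℕ} {s : ℤ → ℤ}

theorem summable_sq_sub (h : IsWord N s) (t : ℤ) : Summable fun i => (s (i + t) - s i) ^ 2 := by
  refine summable_of_ne_finset_zero (s := Finset.Ico (-|t|) (N + |t|)) fun i hi => ?_
  have h1 := le_abs_self t
  have h2 := neg_abs_le t
  simp only [Finset.mem_Ico, not_and_or, not_le, not_lt] at hi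
  rcases hi with hi | hi
  · simp [h.eq_one i (by omega), h.eq_one (i + t) (by omega)]
  · simp [h.eq_zero i (by omega), h.eq_zero (i + t) (by omega)]

theorem hasSum_corr (h : IsWord N s) (t c : ℤ) :
    HasSum (fun i => (s (i + c + t) - s (i + c)) ^ 2) (corr s t) :=
  (Equiv.addRight c).hasSum_iff.2 (h.summable_sq_sub t).hasSum

theorem corr_eq_count (h : IsWord N s) {μ : YoungDiagram} {κ : ℤ}
    (hμ : ∀ x, s x = 1 ↔ ∃ i, x - κ = μ.bead i) {t : ℕ} (ht : 0 < t) :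
    corr s t = 2 * ((μ.cells.val.map μ.hookNumber).count t : ℤ) + t := by
  rw [h.corr_eq, ← μ.ncard_gap_bead ht,
    ← Set.ncard_image_of_injective {y : ℤ | (∀ i, y ≠ μ.bead i) ∧ ∃ i, y + t = μ.bead i}
      (add_left_injective κ)]
  congr 4
  ext y
  have h0 : s y = 0 ↔ ¬ s y = 1 := by
    rcases h.zero_or_one y with h | h <;> simp [h]
  simp only [Set.mem_ofPred_eq, Set.mem_image, h0, hμ, not_exists]
  constructor
  · rintro ⟨h1, i, hi⟩
    exact ⟨y - κ, ⟨h1, i, by rw [← hi]; ring⟩, by ring⟩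
  · rintro ⟨z, ⟨h1, i, hi⟩, rfl⟩
    exact ⟨fun j => by simpa using h1 j, i, by rw [← hi]; ring⟩

end IsWord

theorem YoungDiagram.hookNumbers_pos (μ : YoungDiagram) {t : ℕ}
    (ht : t ∈ μ.cells.val.map μ.hookNumber) : 0 < t := by
  obtain ⟨a, -, rfl⟩ := Multiset.mem_map.1 ht
  exact Nat.succ_pos _

/-- A diagram fixes its word up to translation, and placing the first 0 at position 0 removes that
freedom. -/
theorem IsTrimmed.eq_of_bead {N N' : ℕ} {s s' : ℤ → ℤ} (h : IsTrimmed N s) (h' : IsTrimmed N' s')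
    {μ : YoungDiagram} {κ κ' : ℤ} (hμ : ∀ x, s x = 1 ↔ ∃ i, x - κ = μ.bead i)
    (hμ' : ∀ x, s' x = 1 ↔ ∃ i, x - κ' = μ.bead i) : s = s' := by
  have key : ∀ x, s x = 1 ↔ s' (x - κ + κ') = 1 := fun x => by
    rw [hμ, hμ', add_sub_cancel_right]
  have hκ : κ = κ' := by
    rcases lt_trichotomy κ κ' with hlt | heq | hlt
    · have h1 := h.eq_one (κ - κ') (by omega)
      rw [key, show κ - κ' - κ + κ' = 0 by ring, h'.first] at h1
      omega
    · exact heq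
    · have h1 := (key 0).2 (h'.eq_one _ (by omega))
      rw [h.first] at h1
      omega
  subst hκ
  funext x
  have := key x
  rw [sub_add_cancel] at this
  rcases h.zero_or_one x with h1 | h1 <;> rcases h'.zero_or_one x with h2 | h2 <;>
    omega

/-! ### Envelopes and conjugation. -/

/-- The word `s` followed by its complement, moved by `a`, and by a second copy of `s`,
moved by `b`. -/
def envelope (s : ℤ → ℤ) (a b : ℤ) (i : ℤ) : ℤ := s i - s (i - a) + s (i - b)

/-- The word of the conjugate partition. -/
def conjWord (N : ℕ) (s : ℤ → ℤ) (i : ℤ) : ℤ := 1 - s (N - 1 - i)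

theorem conjWord_conjWord (N : ℕ) (s : ℤ → ℤ) : conjWord N (conjWord N s) = s := by
  funext i
  simp [conjWord]

theorem IsTrimmed.conjWord {N : ℕ} {s : ℤ → ℤ} (h : IsTrimmed N s) :
    IsTrimmed N (conjWord N s) where
  zero_or_one i := by
    unfold _root_.conjWord
    have := h.zero_or_one (N - 1 - i)
    omega
  eq_one i hi := by
    unfold _root_.conjWord
    rw [h.eq_zero _ (by omega), sub_zero]
  eq_zero i hi := by
    unfold _root_.conjWord
    rw [h.eq_one _ (by omega), sub_self]
  first := by
    unfold _root_.conjWord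
    rw [sub_zero, h.last, sub_self]
  last := by
    unfold _root_.conjWord
    rw [sub_self, h.first, sub_zero]

theorem corr_conjWord (N : ℕ) (s : ℤ → ℤ) (t : ℤ) : corr (conjWord N s) t = corr s t := by
  unfold corr
  rw [← (Equiv.subLeft (N - 1 - t : ℤ)).tsum_eq]
  refine tsum_congr fun i => ?_
  simp only [Equiv.subLeft_apply, conjWord]
  rw [show (N : ℤ) - 1 - (N - 1 - t - i + t) = i by ring,
    show (N : ℤ) - 1 - (N - 1 - t - i) = i + t by ring]
  ring

theorem IsTrimmed.envelope {N : ℕ} {s : ℤ → ℤ} (h : IsTrimmed N s) {a b : ℕ} (ha : N ≤ a)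
    (ha0 : 0 < a) (hab : a + N ≤ b) (hab' : a < b) : IsTrimmed (b + N) (envelope s a b) where
  zero_or_one i := by
    unfold _root_.envelope
    rcases lt_or_ge i a with hi | hi
    · rw [h.eq_one (i - a) (by omega), h.eq_one (i - b) (by omega)]
      have := h.zero_or_one i
      omega
    · rw [h.eq_zero i (by omega)]
      rcases lt_or_ge i b with hib | hib
      · rw [h.eq_one (i - b) (by omega)]
        have := h.zero_or_one (i - a)
        omega
      · rw [h.eq_zero (i - a) (by omega)]
        have := h.zero_or_one (i - b)
        omega
  eq_one i hi := by
    unfold _root_.envelope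
    rw [h.eq_one i hi, h.eq_one (i - a) (by omega), h.eq_one (i - b) (by omega)]
    rfl
  eq_zero i hi := by
    unfold _root_.envelope
    push_cast at hi
    rw [h.eq_zero i (by omega), h.eq_zero (i - a) (by omega), h.eq_zero (i - b) (by omega)]
    rfl
  first := by
    unfold _root_.envelope
    rw [h.first, h.eq_one _ (by omega), h.eq_one _ (by omega)]
    rfl
  last := by
    unfold _root_.envelope
    rw [h.eq_zero _ (by push_cast; omega), h.eq_zero _ (by push_cast; omega),
      show ((b + N : ℕ) : ℤ) - 1 - b = N - 1 by push_cast; ring, h.last]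
    rfl

/-- Polarisation, `2(x-y)(z-w) = (x-w)² + (y-z)² - (x-z)² - (y-w)²`, turns each cross term in the
squared difference of the envelope into squared differences of `s`. -/
theorem corr_envelope {N : ℕ} {s : ℤ → ℤ} (h : IsWord N s) (a b t : ℤ) :
    corr (envelope s a b) t = corr s t + corr s t + corr s t
      - (corr s (t + a) + corr s (t - a) - corr s a - corr s a)
      + (corr s (t + b) + corr s (t - b) - corr s b - corr s b)
      - (corr s (t + (b - a)) + corr s (t - (b - a)) - corr s (b - a) - corr s (b - a)) := by
  have H := h.hasSum_corr
  have key := ((((H t 0).add (H t (-a))).add (H t (-b))).sub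
    ((((H (t + a) (-a)).add (H (t - a) 0)).sub (H a (t - a))).sub (H a (-a)))).add
    ((((H (t + b) (-b)).add (H (t - b) 0)).sub (H b (t - b))).sub (H b (-b)))
  have key2 := key.sub
    ((((H (t + (b - a)) (-b)).add (H (t - (b - a)) (-a))).sub (H (b - a) (t - b))).sub
      (H (b - a) (-b)))
  rw [← key2.tsum_eq, corr]
  refine tsum_congr fun i => ?_
  unfold envelope
  ring_nf

theorem envelope_injOn {N a b : ℕ} (ha : N ≤ a) (hab : a ≤ b) :
    Set.InjOn (fun s => envelope s a b) {s | IsTrimmed N s} := by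
  intro s h s' h' heq
  funext i
  rcases lt_or_ge i a with hi | hi
  · have := congrFun heq i
    simp only [envelope] at this
    rw [h.eq_one (i - a) (by omega), h.eq_one (i - b) (by omega), h'.eq_one (i - a) (by omega),
      h'.eq_one (i - b) (by omega)] at this
    omega
  · rw [h.eq_zero i (by omega), h'.eq_zero i (by omega)]

/-- The two words differ at position `a`. There the envelope begins the complement of `s` with a 1;
the mirror position falls in the block of ones from `a + N` to `b`, so the conjugate has a 0. -/
theorem envelope_ne_conjWord {N a b : ℕ} {s s' : ℤ → ℤ} (h : IsTrimmed N s) (h' : IsTrimmed N s')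
    (ha : N ≤ a) (hab : 2 * a < b) :
    envelope s a b ≠ conjWord (b + N) (envelope s' a b) := by
  intro heq
  have := congrFun heq a
  simp only [envelope, conjWord] at this
  rw [h.eq_zero a (by omega), sub_self, h.first, h.eq_one _ (by omega),
    h'.eq_zero _ (by push_cast; omega), h'.eq_zero _ (by push_cast; omega),
    h'.eq_one _ (by push_cast; omega)] at this
  omega

theorem charge_envelope {N : ℕ} {s : ℤ → ℤ} (h : IsWord N s) {a b : ℕ} (hab : a ≤ b) :
    charge (b + N) (envelope s a b) = charge N s + (b - a) ∧
    2 * ∑ x ∈ Finset.range (b + N), (x : ℤ) * envelope s a b x =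
      2 * ∑ x ∈ Finset.range N, (x : ℤ) * s x + 2 * (b - a) * charge N s
        + (b * (b - 1) - a * (a - 1)) := by
  have hshift : ∀ (c d : ℕ) (g : ℕ → ℤ), ∑ x ∈ Finset.range (c + N + d), g x * s (x - c) =
      ∑ x ∈ Finset.range c, g x + ∑ x ∈ Finset.range N, g (c + x) * s x := by
    intro c d g
    rw [Finset.sum_range_add, Finset.sum_range_add]
    have h1 : ∑ x ∈ Finset.range c, g x * s (x - c) = ∑ x ∈ Finset.range c, g x :=
      Finset.sum_congr rfl fun x hx => by
        have := Finset.mem_range.1 hx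
        rw [h.eq_one _ (by omega), mul_one]
    have h2 : ∑ x ∈ Finset.range d, g (c + N + x) * s ((c + N + x : ℕ) - c) = 0 :=
      Finset.sum_eq_zero fun x _ => by
        rw [h.eq_zero _ (by push_cast; omega), mul_zero]
    rw [h1, h2, add_zero]
    congr 1
    refine Finset.sum_congr rfl fun x _ => ?_
    congr 2
    push_cast
    ring
  have hgauss : ∀ c : ℕ, 2 * ∑ x ∈ Finset.range c, (x : ℤ) = c * (c - 1) := fun c => by
    induction c with
    | zero => simp
    | succ c ih =>
      rw [Finset.sum_range_succ, mul_add, ih]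
      push_cast
      ring
  have hsplit : ∀ g : ℕ → ℤ, ∑ x ∈ Finset.range (b + N), g x * envelope s a b x =
      ∑ x ∈ Finset.range N, g x * s x
        - (∑ x ∈ Finset.range a, g x + ∑ x ∈ Finset.range N, g (a + x) * s x)
        + (∑ x ∈ Finset.range b, g x + ∑ x ∈ Finset.range N, g (b + x) * s x) := by
    intro g
    obtain ⟨d, rfl⟩ := Nat.exists_eq_add_of_le hab
    have h0 := hshift 0 (a + d) g
    have h1 := hshift a d g
    have h2 := hshift (a + d) 0 g
    rw [show 0 + N + (a + d) = a + d + N by ring] at h0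
    rw [show a + N + d = a + d + N by ring] at h1
    rw [add_zero] at h2
    simp only [Nat.cast_zero, sub_zero, Finset.range_zero, Finset.sum_empty, zero_add] at h0
    rw [← h0, ← h1, ← h2, ← Finset.sum_sub_distrib, ← Finset.sum_add_distrib]
    refine Finset.sum_congr rfl fun x _ => ?_
    unfold envelope
    ring
  have hlin : ∀ c : ℕ, ∑ x ∈ Finset.range N, ((c + x : ℕ) : ℤ) * s x =
      c * charge N s + ∑ x ∈ Finset.range N, (x : ℤ) * s x := fun c => by
    rw [charge, Finset.mul_sum, ← Finset.sum_add_distrib]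
    refine Finset.sum_congr rfl fun x _ => ?_
    push_cast
    ring
  constructor
  · have := hsplit fun _ => 1
    simp only [one_mul] at this
    unfold charge
    rw [this]
    simp
    ring
  · rw [hsplit fun x => (x : ℤ), hlin, hlin]
    linear_combination hgauss b - hgauss a

theorem doubleSize_envelope {N : ℕ} {s : ℤ → ℤ} (h : IsWord N s) {a b : ℕ} (hab : a ≤ b) :
    doubleSize (b + N) (envelope s a b) = doubleSize N s + 2 * (a * (b - a)) := by
  obtain ⟨h1, h2⟩ := charge_envelope h hab
  unfold doubleSize
  rw [h1, h2]
  ring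

/-! ### Families with common hook numbers. -/

/-- A set of words of length `N` that have the same hook numbers, for partitions of `n`. -/
structure IsFamily (S : Finset (ℤ → ℤ)) (N n : ℕ) : Prop where
  isTrimmed : ∀ s ∈ S, IsTrimmed N s
  corr_eq : ∀ s ∈ S, ∀ s' ∈ S, ∀ t, corr s t = corr s' t
  size : ∃ s ∈ S, doubleSize N s = 2 * n

theorem IsWord.corr_eq_self {N : ℕ} {s : ℤ → ℤ} (h : IsWord N s) {t : ℕ} (ht : N ≤ t) :
    corr s t = t := by
  have : {y : ℤ | s y = 0 ∧ s (y + t) = 1} = ∅ := by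
    refine Set.eq_empty_iff_forall_notMem.2 fun y hy => ?_
    obtain ⟨h0, h1⟩ := hy
    rcases lt_or_ge y 0 with hy | hy
    · have := h.eq_one y hy
      omega
    · have := h.eq_zero (y + t) (by omega)
      omega
  rw [h.corr_eq, this]
  simp

theorem IsWord.lt_corr {N : ℕ} {s : ℤ → ℤ} (h : IsWord N s) {t : ℕ} {y : ℤ} (h0 : s y = 0)
    (h1 : s (y + t) = 1) : (t : ℤ) < corr s t := by
  have hfin : {y : ℤ | s y = 0 ∧ s (y + t) = 1}.Finite := by
    refine (Set.finite_Ico (0 : ℤ) N).subset fun y hy => ?_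
    obtain ⟨h0, h1⟩ := hy
    constructor
    · by_contra hlt
      have := h.eq_one y (by omega)
      omega
    · by_contra hlt
      have := h.eq_zero (y + t) (by omega)
      omega
  have := (Set.ncard_pos hfin).2 ⟨y, h0, h1⟩
  rw [h.corr_eq]
  omega

namespace IsFamily

theorem double {S : Finset (ℤ → ℤ)} {N n : ℕ} (h : IsFamily S N n) {a b : ℕ} (ha : N ≤ a)
    (ha0 : 0 < a) (hab : 2 * a < b) :
    ∃ S' : Finset (ℤ → ℤ), IsFamily S' (b + N) (n + a * (b - a)) ∧ S'.card = 2 * S.card ∧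
      ∀ t : ℕ, a + N ≤ t → t < b → ∀ s ∈ S', (t : ℤ) < corr s t := by
  classical
  have htrim : ∀ s ∈ S, IsTrimmed (b + N) (envelope s a b) := fun s hs =>
    (h.isTrimmed s hs).envelope ha ha0 (by omega) (by omega)
  set S₁ := S.image fun s => envelope s a b with hS₁
  set S₂ := S₁.image (conjWord (b + N)) with hS₂
  have hcard₁ : S₁.card = S.card := Finset.card_image_of_injOn fun s hs s' hs' heq =>
    envelope_injOn ha (by omega) (h.isTrimmed s hs) (h.isTrimmed s' hs') heq
  have hcard₂ : S₂.card = S₁.card := Finset.card_image_of_injective _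
    (Function.LeftInverse.injective (conjWord_conjWord (b + N)))
  have hdisj : Disjoint S₁ S₂ := by
    rw [Finset.disjoint_left]
    intro w h1 h2
    obtain ⟨s, hs, rfl⟩ := Finset.mem_image.1 h1
    obtain ⟨w', hw', heq⟩ := Finset.mem_image.1 h2
    obtain ⟨s', hs', rfl⟩ := Finset.mem_image.1 hw'
    exact envelope_ne_conjWord (h.isTrimmed s hs) (h.isTrimmed s' hs') ha hab heq.symm
  obtain ⟨s₀, hs₀, hsize⟩ := h.size
  have hmem₀ : envelope s₀ a b ∈ S₁ := Finset.mem_image_of_mem _ hs₀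
  have hcorr₁ : ∀ w ∈ S₁, ∀ t, corr w t = corr (envelope s₀ a b) t := by
    intro w hw t
    obtain ⟨s, hs, rfl⟩ := Finset.mem_image.1 hw
    simp only [corr_envelope (h.isTrimmed s hs).toIsWord,
      corr_envelope (h.isTrimmed s₀ hs₀).toIsWord, h.corr_eq s hs s₀ hs₀]
  have hcorr : ∀ w ∈ S₁ ∪ S₂, ∀ t, corr w t = corr (envelope s₀ a b) t := by
    intro w hw t
    rcases Finset.mem_union.1 hw with hw | hw
    · exact hcorr₁ w hw t
    · obtain ⟨w', hw', rfl⟩ := Finset.mem_image.1 hw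
      rw [corr_conjWord, hcorr₁ w' hw']
  refine ⟨S₁ ∪ S₂, ⟨fun w hw => ?_, fun w hw w' hw' t => ?_, envelope s₀ a b, ?_, ?_⟩, ?_,
    fun t hat htb w hw => ?_⟩
  · rcases Finset.mem_union.1 hw with hw | hw
    · obtain ⟨s, hs, rfl⟩ := Finset.mem_image.1 hw
      exact htrim s hs
    · obtain ⟨w', hw', rfl⟩ := Finset.mem_image.1 hw
      obtain ⟨s, hs, rfl⟩ := Finset.mem_image.1 hw'
      exact (htrim s hs).conjWord
  · rw [hcorr w hw, hcorr w' hw']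
  · exact Finset.mem_union_left _ hmem₀
  · rw [doubleSize_envelope (h.isTrimmed s₀ hs₀).toIsWord (by omega), hsize]
    push_cast [show a ≤ b by omega]
    ring
  · rw [Finset.card_union_of_disjoint hdisj, hcard₂, hcard₁, two_mul]
  · rw [hcorr w hw]
    have hs := h.isTrimmed s₀ hs₀
    -- The initial 0 pairs with each 1 in the constant block `[a + N, b)`.
    refine (htrim s₀ hs₀).lt_corr (htrim s₀ hs₀).first ?_
    unfold envelope
    rw [hs.eq_zero _ (by omega), hs.eq_zero _ (by omega), hs.eq_one _ (by omega)]
    rfl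

/-- Take `l` rows of length 16 and one of length `r`, where `n = r + 16 * l`. The word has length
`17 + l`, which is at most `n / 4` once `n ≥ 100`. -/
theorem exists_singleton {n : ℕ} (hn : 100 ≤ n) :
    ∃ S N, IsFamily S N n ∧ S.card = 1 ∧ 4 * N ≤ n := by
  obtain ⟨r, l, hr1, hr2, hl, rfl⟩ : ∃ r l, 1 ≤ r ∧ r ≤ 16 ∧ 1 ≤ l ∧ n = r + 16 * l :=
    ⟨(n - 1) % 16 + 1, (n - 1) / 16, by omega, by omega, by omega, by omega⟩
  let w : ℤ → ℤ := fun i =>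
    if i < 0 ∨ i = r ∨ 17 ≤ i ∧ i < 17 + l then 1 else 0
  have h1 : ∀ g : ℕ → ℤ, ∑ x ∈ Finset.range 17, g x * w x = g r := by
    intro g
    rw [Finset.sum_eq_single r]
    · simp [w]
    · intro x hx hxr
      have := Finset.mem_range.1 hx
      have : w x = 0 := if_neg (by omega)
      rw [this, mul_zero]
    · intro hr
      exact absurd (Finset.mem_range.2 (by omega)) hr
  have h2 : ∀ g : ℕ → ℤ, ∑ x ∈ Finset.range (17 + l), g x * w x =
      g r + ∑ x ∈ Finset.range l, g (17 + x) := by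
    intro g
    rw [Finset.sum_range_add, h1]
    congr 1
    refine Finset.sum_congr rfl fun x hx => ?_
    have := Finset.mem_range.1 hx
    have : w (17 + x : ℕ) = 1 := if_pos (by omega)
    rw [this, mul_one]
  have h3 : ∀ c : ℕ, 2 * ∑ x ∈ Finset.range c, ((17 + x : ℕ) : ℤ) = 34 * c + c * (c - 1) := by
    intro c
    induction c with
    | zero => simp
    | succ c ih =>
      rw [Finset.sum_range_succ, mul_add, ih]
      push_cast
      ring
  refine ⟨{w}, 17 + l, ⟨?_, ?_, w, Finset.mem_singleton_self w, ?_⟩, Finset.card_singleton w,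
    by omega⟩
  · intro s hs
    rw [Finset.mem_singleton.1 hs]
    refine ⟨⟨fun i => ?_, fun i hi => if_pos (Or.inl hi), fun i hi => if_neg ?_⟩, if_neg ?_,
      if_pos ?_⟩
    · unfold w
      split_ifs <;> simp
    · push_cast at hi
      omega
    · omega
    · push_cast
      omega
  · intro s hs s' hs' t
    rw [Finset.mem_singleton.1 hs, Finset.mem_singleton.1 hs']
  · have hc : charge (17 + l) w = 1 + l := by
      simpa [charge] using h2 fun _ => 1
    rw [doubleSize, hc, h2, mul_add, h3]
    push_cast
    ring

theorem exists_of_weak {m : ℕ}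
    (hweak : ∃ n₀, ∀ n ≥ n₀, ∃ S N, IsFamily S N n ∧ S.card = 2 ^ m ∧ 4 * N ≤ n) :
    ∃ q₀ ≥ 2, ∀ q ≥ q₀, ∀ n ≥ 8 * q ^ 2, ∃ S M, IsFamily S M n ∧ S.card = 2 ^ (m + 1) ∧
      q * M ≤ 2 * n ∧ ∀ t : ℕ, 2 * q ≤ t → 2 * q * t ≤ n → ∀ s ∈ S, (t : ℤ) < corr s t := by
  obtain ⟨n₀, hn₀⟩ := hweak
  refine ⟨max n₀ 2, le_max_right _ _, fun q hq n hn => ?_⟩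
  have hq0 : n₀ ≤ q := (le_max_left _ _).trans hq
  have hq2 : 2 ≤ q := (le_max_right _ _).trans hq
  -- With `n / q = B + 1`, the size is `n = (q + n % q) + q * B`. The bracket is below `2 * q`, so
  -- the inner words have length below `q / 2`; the envelope with `a = q`, `b = q + B` supplies the
  -- rest.
  obtain ⟨S, N, hS, hcard, hN⟩ := hn₀ (q + n % q) (by omega)
  have hmod := Nat.mod_lt n (show 0 < q by omega)
  have hdiv := Nat.div_add_mod n q
  have hlarge : 8 * q ≤ n / q := by
    rw [Nat.le_div_iff_mul_le (by omega)]
    nlinarith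
  obtain ⟨B, hB⟩ : ∃ B, n / q = B + 1 := ⟨n / q - 1, by omega⟩
  rw [hB] at hdiv hlarge
  obtain ⟨S', hS', hcard', hhook⟩ := hS.double (a := q) (b := q + B) (by omega) (by omega) (by omega)
  have hn' : q + n % q + q * (q + B - q) = n := by
    rw [Nat.add_sub_cancel_left]
    linarith
  rw [hn'] at hS'
  refine ⟨S', q + B + N, hS', by rw [hcard', hcard, pow_succ, mul_comm], ?_, fun t ht1 ht2 => ?_⟩
  · nlinarith
  · refine hhook t (by omega) ?_
    by_contra hlt
    have : q * (q + B) ≤ q * t := Nat.mul_le_mul_left q (by omega)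
    nlinarith

theorem exists_weak (m : ℕ) :
    ∃ n₀, ∀ n ≥ n₀, ∃ S N, IsFamily S N n ∧ S.card = 2 ^ m ∧ 4 * N ≤ n := by
  induction m with
  | zero => exact ⟨100, fun n hn => exists_singleton hn⟩
  | succ m ih =>
    obtain ⟨q₀, -, h⟩ := exists_of_weak ih
    -- Taking `q ≥ 8` turns `q * M ≤ 2 * n` into the bound `4 * M ≤ n` needed for the next doubling.
    refine ⟨8 * (max q₀ 8) ^ 2, fun n hn => ?_⟩
    obtain ⟨S, M, hS, hcard, hM, -⟩ := h (max q₀ 8) (le_max_left _ _) n hn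
    have := Nat.mul_le_mul_right M (le_max_right q₀ 8)
    exact ⟨S, M, hS, hcard, by omega⟩

theorem exists_partition {S : Finset (ℤ → ℤ)} {N n : ℕ} (h : IsFamily S N n) {s : ℤ → ℤ}
    (hs : s ∈ S) :
    ∃ p : Nat.Partition n, ∃ κ : ℤ, ∀ x, s x = 1 ↔ ∃ i, x - κ = p.diagram.bead i := by
  obtain ⟨s₀, hs₀, hsize⟩ := h.size
  have hw := (h.isTrimmed s hs).toIsWord
  have hw₀ := (h.isTrimmed s₀ hs₀).toIsWord
  obtain ⟨μ, hμ, -⟩ := hw.exists_youngDiagram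
  obtain ⟨μ₀, hμ₀, hcard⟩ := hw₀.exists_youngDiagram
  -- The size is known for one word only; equal hook multisets transfer it, as their cardinality is
  -- the number of boxes.
  have hhook : μ.cells.val.map μ.hookNumber = μ₀.cells.val.map μ₀.hookNumber := by
    ext t
    rcases Nat.eq_zero_or_pos t with rfl | ht
    · rw [Multiset.count_eq_zero_of_notMem fun h => (μ.hookNumbers_pos h).false,
        Multiset.count_eq_zero_of_notMem fun h => (μ₀.hookNumbers_pos h).false]
    · have h1 := hw.corr_eq_count hμ ht
      have h2 := hw₀.corr_eq_count hμ₀ ht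
      rw [h.corr_eq s hs s₀ hs₀] at h1
      omega
  have hn : μ.card = n := by
    have h1 := congrArg Multiset.card hhook
    rw [Multiset.card_map, Multiset.card_map] at h1
    change μ.card = μ₀.card at h1
    omega
  subst hn
  obtain ⟨p, hp⟩ := μ.exists_partition_diagram_eq
  exact ⟨p, charge N s, by rwa [hp]⟩

theorem exists_partitions {S : Finset (ℤ → ℤ)} {N n : ℕ} (h : IsFamily S N n) :
    ∃ Λ : Finset (Nat.Partition n), Λ.card = S.card ∧ ∃ s ∈ S, ∀ p ∈ Λ, ∀ t : ℕ, 0 < t →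
      corr s t = 2 * (p.hookNumbers.count t : ℤ) + t := by
  classical
  choose f κ hf using fun s : S => h.exists_partition s.2
  obtain ⟨s₀, hs₀, -⟩ := h.size
  refine ⟨S.attach.image f, ?_, s₀, hs₀, fun p hp t ht => ?_⟩
  · rw [Finset.card_image_of_injective, Finset.card_attach]
    intro s s' heq
    have h1 := hf s
    rw [heq] at h1
    exact Subtype.ext ((h.isTrimmed s s.2).eq_of_bead (h.isTrimmed s' s'.2) h1 (hf s'))
  · obtain ⟨s, -, rfl⟩ := Finset.mem_image.1 hp
    rw [h.corr_eq s₀ hs₀ s s.2]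
    exact (h.isTrimmed s s.2).corr_eq_count (hf s) ht

end IsFamily

/-! ### Separating the hook products. -/

theorem Nat.Partition.pos_of_mem_hookNumbers {n : ℕ} (p : n.Partition) {t : ℕ}
    (ht : t ∈ p.hookNumbers) : 0 < t :=
  p.diagram.hookNumbers_pos ht

theorem exists_hookNumbers_family (ℓ : ℕ) :
    ∃ q₀ ≥ 2, ∀ q ≥ q₀, ∀ n ≥ 8 * q ^ 2, ∃ Λ : Finset (Nat.Partition n), Λ.card = ℓ ∧
      (∀ p ∈ Λ, ∀ p' ∈ Λ, p.hookNumbers = p'.hookNumbers) ∧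
      (∀ p ∈ Λ, ∀ t ∈ p.hookNumbers, q * t ≤ 2 * n) ∧
      ∀ p ∈ Λ, ∀ t, 2 * q ≤ t → 2 * q * t ≤ n → t ∈ p.hookNumbers := by
  obtain ⟨q₀, hq₀, H⟩ := IsFamily.exists_of_weak (IsFamily.exists_weak ℓ)
  refine ⟨q₀, hq₀, fun q hq n hn => ?_⟩
  obtain ⟨S, M, hS, hcard, hM, hhook⟩ := H q hq n hn
  obtain ⟨Λ', hΛ', s, hs, hcount⟩ := hS.exists_partitions
  obtain ⟨Λ, hsub, hΛ⟩ := Finset.exists_subset_card_eq (s := Λ') (n := ℓ) (by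
    rw [hΛ', hcard]
    exact (Nat.lt_two_pow_self.trans (Nat.pow_lt_pow_right one_lt_two (Nat.lt_succ_self ℓ))).le)
  refine ⟨Λ, hΛ, fun p hp p' hp' => ?_, fun p hp t ht => ?_, fun p hp t ht1 ht2 => ?_⟩
  · ext t
    rcases Nat.eq_zero_or_pos t with rfl | ht
    · rw [Multiset.count_eq_zero_of_notMem fun h => (p.pos_of_mem_hookNumbers h).false,
        Multiset.count_eq_zero_of_notMem fun h => (p'.pos_of_mem_hookNumbers h).false]
    · have h1 := hcount p (hsub hp) t ht
      have h2 := hcount p' (hsub hp') t ht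
      omega
  · have h1 := hcount p (hsub hp) t (p.pos_of_mem_hookNumbers ht)
    have h2 := Multiset.count_pos.2 ht
    have htM : t < M := by
      by_contra hle
      have := (hS.isTrimmed s hs).corr_eq_self (not_lt.1 hle)
      omega
    exact (Nat.mul_le_mul_left q htM.le).trans hM
  · have h1 := hcount p (hsub hp) t (by omega)
    have h2 := hhook t ht1 ht2 s hs
    exact Multiset.count_pos.1 (by omega)

theorem prod_hookNumbers_ne {n q q' : ℕ} (hq : 2 ≤ q) (hqq : 16 * q ≤ q') (hn : 8 * q ^ 2 ≤ n)
    {p p' : n.Partition} (hp : ∀ t, 2 * q ≤ t → 2 * q * t ≤ n → t ∈ p.hookNumbers)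
    (hp' : ∀ t ∈ p'.hookNumbers, q' * t ≤ 2 * n) :
    p.hookNumbers.prod ≠ p'.hookNumbers.prod := by
  have hT : 2 * q ≤ n / (4 * q) := by
    rw [Nat.le_div_iff_mul_le (by omega)]
    nlinarith
  -- The prime satisfies `n/(4q) < r ≤ n/(2q)`, so it is a hook of `p`. A hook of `p'` divisible by
  -- `r` would be at least `r`, whereas those hooks are at most `2n/q' ≤ n/(8q)`.
  obtain ⟨r, hr, h1, h2⟩ := Nat.exists_prime_lt_and_le_two_mul (n / (4 * q)) (by omega)
  have h3 : n < 4 * q * r := by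
    rw [mul_comm]
    exact (Nat.div_lt_iff_lt_mul (by omega)).1 h1
  have h4 := Nat.mul_div_le n (4 * q)
  intro heq
  have hdvd : r ∣ p'.hookNumbers.prod :=
    heq ▸ Multiset.dvd_prod (hp r (by omega) (by nlinarith))
  obtain ⟨t, ht, hrt⟩ := hr.prime.exists_mem_multiset_dvd hdvd
  have hle := Nat.le_of_dvd (p'.pos_of_mem_hookNumbers ht) hrt
  have h5 := hp' t ht
  have h6 : 16 * q * r ≤ q' * t := Nat.mul_le_mul hqq hle
  nlinarith

theorem mainTheorem4 (k ℓ : ℕ) :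
    ∃ N : ℕ, ∀ n : ℕ, N ≤ n →
      ∃ Λ : Fin k → Finset (Nat.Partition n),
        (∀ i j, i ≠ j → Disjoint (Λ i) (Λ j)) ∧
        (∀ i, (Λ i).card = ℓ) ∧
        (∀ i, ∀ p ∈ Λ i, ∀ q ∈ Λ i, p.hookNumbers = q.hookNumbers) ∧
        (∀ i j, i ≠ j → ∀ p ∈ Λ i, ∀ q ∈ Λ j,
          p.hookNumbers ≠ q.hookNumbers ∧ p.hookNumbers.prod ≠ q.hookNumbers.prod) := by
  obtain ⟨q₀, hq₀, H⟩ := exists_hookNumbers_family ℓ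
  refine ⟨8 * (q₀ * 16 ^ k) ^ 2, fun n hn => ?_⟩
  have hge : ∀ i : ℕ, q₀ ≤ q₀ * 16 ^ i := fun i => Nat.le_mul_of_pos_right _ (by positivity)
  have hlarge : ∀ i : Fin k, 8 * (q₀ * 16 ^ (i : ℕ)) ^ 2 ≤ n := fun i => by
    refine le_trans ?_ hn
    have := Nat.pow_le_pow_right (show 0 < 16 by norm_num) i.2.le
    gcongr
  -- The scales `q₀ * 16 ^ i` are spaced by the factor that `prod_hookNumbers_ne` requires.
  choose Λ hcard heq hupper hmem using fun i : Fin k => H _ (hge i) n (hlarge i)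
  have hlt : ∀ i j, i < j → ∀ p ∈ Λ i, ∀ p' ∈ Λ j,
      p.hookNumbers.prod ≠ p'.hookNumbers.prod := by
    intro i j hij p hp p' hp'
    refine prod_hookNumbers_ne (hq₀.trans (hge i)) ?_ (hlarge i) (hmem i p hp) (hupper j p' hp')
    have := Nat.pow_le_pow_right (show 0 < 16 by norm_num) (show (i : ℕ) + 1 ≤ j from hij)
    calc 16 * (q₀ * 16 ^ (i : ℕ)) = q₀ * 16 ^ ((i : ℕ) + 1) := by ring
      _ ≤ q₀ * 16 ^ (j : ℕ) := Nat.mul_le_mul_left _ this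
  have hne : ∀ i j, i ≠ j → ∀ p ∈ Λ i, ∀ p' ∈ Λ j,
      p.hookNumbers.prod ≠ p'.hookNumbers.prod := by
    intro i j hij p hp p' hp'
    rcases lt_or_gt_of_ne hij with h | h
    · exact hlt i j h p hp p' hp'
    · exact (hlt j i h p' hp' p hp).symm
  exact ⟨Λ, fun i j hij => Finset.disjoint_left.2 fun p hp hp' => hne i j hij p hp p hp' rfl,
    hcard, heq, fun i j hij p hp p' hp' =>
      ⟨fun h => hne i j hij p hp p' hp' (congrArg Multiset.prod h), hne i j hij p hp p' hp'⟩⟩
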